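/- Let $t\ge 1$ be an integer, $N=(t+1)^2$, and let $\mathbb S^2\subset\mathbb R^3$ be the unit sphere with surface measure $\omega$ (total mass $4\pi$). A spherical polynomial of degree $\le t$ is the restriction to $\mathbb S^2$ of a real polynomial of degree $\le t$. Fix any $L_2(\omega)$-orthonormal system of real spherical harmonics $Y_{\ell,k}$, $0\le\ell\le t$, $1\le k\le 2\ell+1$, with $Y_{\ell,k}$ of degree $\ell$. For a set $X=\{x_1,\dots,x_N\}\subset\mathbb S^2$ of $N$ distinct points let $Y(X)\in\mathbb R^{N\times N}$ be the matrix with entries $Y(X)_{i,\ell^2+k}=Y_{\ell,k}(x_i)$, let $\|\cdot\|_1$ be the maximal absolute column sum of a matrix, and put $\operatorname{dist}(x,y)=\arccos(x\cdot y)$, $\rho(X)=\min_{i\ne j}\operatorname{dist}(x_i,x_j)$, and, for another such set $X'=\{x_1',\dots,x_N'\}$, $$\sigma(X,X')=\max\Big\{\max_i\min_j\operatorname{dist}(x_i',x_j),\ \max_j\min_i\operatorname{dist}(x_i',x_j)\Big\}.$$ Call $X$ fundamental with order $t$ if the only spherical polynomial of degree $\le t$ vanishing at all points of $X$ is zero;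 a spherical $t$-design if $\frac1N\sum_{j}p(x_j)=\frac1{4\pi}\int_{\mathbb S^2}p\,d\omega$ for all spherical polynomials $p$ of degree $\le t$; and, for $0\le\epsilon<1$, a spherical $t_\epsilon$-design if there are weights $w_1,\dots,w_N$ with $\frac{4\pi}N(1-\epsilon)\le w_i\le\frac{4\pi}N(1-\epsilon)^{-1}$ for all $i$ and $\sum_i w_i\,p(x_i)=\int_{\mathbb S^2}p\,d\omega$ for all spherical polynomials $p$ of degree $\le t$. Let $X_N^0$ be a set of $N=(t+1)^2$ points that is a spherical $t$-design and fundamental with order $t$ (so that $Y(X_N^0)$ is invertible), let $\tau=\sqrt{\frac{2t+1}{4\pi}}\,(t+1)^3$, and let $$0\le\sigma^*<\frac12\min\Big(\frac1{\tau\|Y(X_N^0)^{-1}\|_1},\ \rho(X_N^0)\Big).$$ Then every set $X_N\subset\mathbb S^2$ of $N$ distinct points with $\sigma(X_N,X_N^0)\le\sigma^*$ is fundamental with order $t$, and is a spherical $t_\epsilon$-design for every $\epsilon$ with $$\frac{\tau\sigma^*\|Y(X_N^0)^{-1}\|_1}{1-\tau\sigma^*\|Y(X_N^0)^{-1}\|_1}\le\epsilon<1.$$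 -/

import Mathlib

noncomputable section

namespace SphericalDesign

open MeasureTheory

/-- The unit sphere of `ℝ³`, as a type. -/
abbrev S2 : Type := Metric.sphere (0 : EuclideanSpace ℝ (Fin 3)) 1

/-- The surface measure on the unit sphere (induced by Lebesgue measure through polar
coordinates); its total mass is the area `4π`. -/
def surfaceMeasure : Measure S2 := (volume : Measure (EuclideanSpace ℝ (Fin 3))).toSphere

/-- The area of the unit sphere. -/
def area : ℝ := surfaceMeasure.real Set.univ

/-- `f` is a spherical polynomial of degree at most `t`: the restriction to the sphere of a real
polynomial in three variables of total degree at most `t`. -/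
def IsSphericalPolynomial (t : ℕ) (f : S2 → ℝ) : Prop :=
  ∃ p : MvPolynomial (Fin 3) ℝ, p.totalDegree ≤ t ∧
    ∀ x : S2, f x = MvPolynomial.eval (fun i => x.1 i) p

/-- `f` is a real spherical harmonic of degree `l`: the restriction to the sphere of a real
homogeneous polynomial of degree `l` in three variables whose Laplacian vanishes. -/
def IsSphericalHarmonic (l : ℕ) (f : S2 → ℝ) : Prop :=
  ∃ p : MvPolynomial (Fin 3) ℝ, p.IsHomogeneous l ∧
    ∑ i, MvPolynomial.pderiv i (MvPolynomial.pderiv i p) = 0 ∧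
    ∀ x : S2, f x = MvPolynomial.eval (fun i => x.1 i) p

/-- `Y l k`, for `0 ≤ l ≤ t` and `1 ≤ k ≤ 2l + 1`, is a system of `L²`-orthonormal real spherical
harmonics, `Y l k` being of degree `l`. (Values of `Y` at other indices are irrelevant.) -/
structure IsOrthonormalHarmonicSystem (t : ℕ) (Y : ℕ → ℕ → S2 → ℝ) : Prop where
  harmonic : ∀ l ≤ t, ∀ k ∈ Finset.Icc 1 (2 * l + 1), IsSphericalHarmonic l (Y l k)
  orthonormal : ∀ l ≤ t, ∀ l' ≤ t, ∀ k ∈ Finset.Icc 1 (2 * l + 1),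
    ∀ k' ∈ Finset.Icc 1 (2 * l' + 1),
      ∫ x, Y l k x * Y l' k' x ∂surfaceMeasure = if l = l' ∧ k = k' then 1 else 0

/-- A set of `N` (distinct) points of the sphere, with a numbering of its points. -/
abbrev PointSet (N : ℕ) : Type := Fin N ↪ S2

/-- `X` is fundamental with order `t`: the zero polynomial is the only spherical polynomial of
degree at most `t` vanishing at all the points of `X`. -/
def IsFundamental (t : ℕ) {N : ℕ} (X : PointSet N) : Prop :=
  ∀ f : S2 → ℝ, IsSphericalPolynomial t f → (∀ i, f (X i) = 0) → ∀ x, f x = 0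

/-- `X` is a spherical `t`-design. -/
def IsDesign (t : ℕ) {N : ℕ} (X : PointSet N) : Prop :=
  ∀ f : S2 → ℝ, IsSphericalPolynomial t f →
    1 / (N : ℝ) * ∑ j, f (X j) = 1 / area * ∫ x, f x ∂surfaceMeasure

/-- `X` is a spherical `t_ε`-design, `0 ≤ ε < 1`. -/
def IsEpsDesign (t : ℕ) (ε : ℝ) {N : ℕ} (X : PointSet N) : Prop :=
  0 ≤ ε ∧ ε < 1 ∧ ∃ w : Fin N → ℝ,
    (∀ i, area / N * (1 - ε) ≤ w i ∧ w i ≤ area / N * (1 - ε)⁻¹) ∧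
    ∀ f : S2 → ℝ, IsSphericalPolynomial t f →
      ∑ i, w i * f (X i) = ∫ x, f x ∂surfaceMeasure

/-- The geodesic distance on the sphere. -/
def geodist (x y : S2) : ℝ := Real.arccos (inner ℝ x.1 y.1)

/-- The separation distance: the least geodesic distance between two different points of `X`
(for `N ≥ 2`, so that the minimum is over a non-empty finite family). -/
def separation {N : ℕ} (X : PointSet N) : ℝ :=
  ⨅ p : {p : Fin N × Fin N // p.1 ≠ p.2}, geodist (X p.1.1) (X p.1.2)

/-- The least distance from a point to a point set. -/
def leastDist {N : ℕ} (x : S2) (X : PointSet N) : ℝ := ⨅ i, geodist x (X i)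

/-- The Hausdorff distance of two point sets with `N` points each. -/
def hausdorff {N : ℕ} (X X' : PointSet N) : ℝ :=
  max (⨆ i, leastDist (X' i) X) (⨆ i, leastDist (X i) X')

/-- The closed neighbourhood of `X` with radius `σ` in the Hausdorff distance. -/
def neighborhood {N : ℕ} (X : PointSet N) (σ : ℝ) : Set (PointSet N) :=
  {X' | hausdorff X' X ≤ σ}

/-- The `N × (t+1)²` matrix of the values `Y l k (xᵢ)`. Columns are numbered from `0`: the pair
`(l, k)` with `1 ≤ k ≤ 2l + 1` has column `j = l² + k - 1`, that is, `l` is the integer square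
root of `j` and `k = j - l² + 1`. -/
def harmonicMatrix (t : ℕ) (Y : ℕ → ℕ → S2 → ℝ) {N : ℕ} (X : PointSet N) :
    Matrix (Fin N) (Fin ((t + 1) ^ 2)) ℝ :=
  Matrix.of fun i j => Y (Nat.sqrt j) (j - Nat.sqrt j ^ 2 + 1) (X i)

/-- The matrix norm induced by the `1`-norm: the maximal absolute column sum. -/
def oneNorm {m n : ℕ} (A : Matrix (Fin m) (Fin n) ℝ) : ℝ := ⨆ j, ∑ i, |A i j|

/-- The constant `τ = √((2t+1)/(4π)) (t+1)³`. -/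
def tau (t : ℕ) : ℝ := Real.sqrt ((2 * t + 1) / (4 * Real.pi)) * (t + 1) ^ 3

end SphericalDesign

end

/-! The design property says that the row vector with all entries `a = 4π/N` maps the matrix `A₀` of
values at `X₀` to the vector of integrals of the basis. After matching the points of `X` with those
of `X₀`, the matrix `A` at `X` differs from `A₀` by column sums at most `τσ`. With `r = τσ‖A₀⁻¹‖₁ <
1`, a row vector `w` with `wA = a𝟙A₀` satisfies `w - a𝟙 = -w(A - A₀)A₀⁻¹`, so `|wᵢ - a| ≤ r max|w|`
and hence `|wᵢ - a| ≤ a r/(1 - r) ≤ εa` (`abs_sub_const_le`). The same identity with right-hand side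
zero makes `A` invertible, so `X` is fundamental, and `w` gives the weights.

The analytic input is a Lipschitz bound for the harmonics (`sum_sq_sub_le`). An orthonormal system
of `2l+1` harmonics of degree `l` spans them all, so isometries act on it by orthogonal matrices and
its kernel is invariant. Hence `∑ₖ (yₖ(z) - yₖ(x))²` equals its average over all pairs at the same
distance on the great circle through `x` and `z`. There each `yₖ` is a trigonometric polynomial of
degree at most `l`, and Parseval bounds the mean square of its increments. -/

noncomputable section

namespace SphericalDesign

open MeasureTheory
open scoped Pointwise

/-! ### Harmonic polynomials: the dimension is at most `2l + 1`. -/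

/-- The harmonic homogeneous polynomials of degree `l` in three variables. -/
def harmonicPolynomial (l : ℕ) : Submodule ℝ (MvPolynomial (Fin 3) ℝ) where
  carrier := {p | p.IsHomogeneous l ∧ ∑ i, MvPolynomial.pderiv i (MvPolynomial.pderiv i p) = 0}
  add_mem' := by
    rintro p q ⟨hp, hp'⟩ ⟨hq, hq'⟩
    exact ⟨hp.add hq, by simp only [map_add, Finset.sum_add_distrib, hp', hq', add_zero]⟩
  zero_mem' := ⟨MvPolynomial.isHomogeneous_zero _ _ _, by simp⟩
  smul_mem' := by
    rintro c p ⟨hp, hp'⟩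
    refine ⟨(MvPolynomial.homogeneousSubmodule (Fin 3) ℝ l).smul_mem c hp, ?_⟩
    simp only [Derivation.map_smul, ← Finset.smul_sum, hp', smul_zero]

/-- The exponent vector of the monomial `x ^ a * y ^ b * z ^ c`. -/
def exponent (a b c : ℕ) : Fin 3 →₀ ℕ :=
  Finsupp.single 0 a + Finsupp.single 1 b + Finsupp.single 2 c

lemma exponent_eta (m : Fin 3 →₀ ℕ) : exponent (m 0) (m 1) (m 2) = m := by
  ext i
  fin_cases i <;> simp [exponent]

lemma degree_exponent (a b c : ℕ) : (exponent a b c).degree = a + b + c := by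
  simp [exponent, Finsupp.degree_single]

lemma coeff_pderiv (p : MvPolynomial (Fin 3) ℝ) (i : Fin 3) (m : Fin 3 →₀ ℕ) :
    (MvPolynomial.pderiv i p).coeff m = p.coeff (m + Finsupp.single i 1) * (m i + 1) := by
  classical
  induction p using MvPolynomial.induction_on' with
  | monomial s a =>
    rw [MvPolynomial.pderiv_monomial, MvPolynomial.coeff_monomial, MvPolynomial.coeff_monomial]
    by_cases h : s = m + Finsupp.single i 1
    · subst h
      simp
    · rw [if_neg h, zero_mul, ite_eq_right_iff]
      intro h'
      -- If `s i = 0`, truncated subtraction leaves `s` unchanged and `h'` is useless, but the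
      -- factor `s i` vanishes.
      by_cases hs : s i = 0
      · simp [hs]
      · refine absurd ?_ h
        rw [← h', tsub_add_cancel_of_le]
        rw [Finsupp.single_le_iff]
        omega
  | add p q hp hq => rw [map_add, MvPolynomial.coeff_add, MvPolynomial.coeff_add, hp, hq, add_mul]

/-- A coefficient of the Laplacian, read as a recursion that raises the exponent of the last
variable by two. -/
lemma coeff_harmonic {l : ℕ} {p : MvPolynomial (Fin 3) ℝ} (hp : p ∈ harmonicPolynomial l)
    (a b c : ℕ) :
    p.coeff (exponent (a + 2) b c) * ((a + 2) * (a + 1))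
      + p.coeff (exponent a (b + 2) c) * ((b + 2) * (b + 1))
      + p.coeff (exponent a b (c + 2)) * ((c + 2) * (c + 1)) = 0 := by
  have h := congrArg (MvPolynomial.coeff (exponent a b c)) hp.2
  rw [MvPolynomial.coeff_sum, Fin.sum_univ_three] at h
  simp only [coeff_pderiv, MvPolynomial.coeff_zero] at h
  have e0 : exponent a b c + Finsupp.single 0 1 + Finsupp.single 0 1 = exponent (a + 2) b c := by
    ext i; fin_cases i <;> simp [exponent]
  have e1 : exponent a b c + Finsupp.single 1 1 + Finsupp.single 1 1 = exponent a (b + 2) c := by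
    ext i; fin_cases i <;> simp [exponent]
  have e2 : exponent a b c + Finsupp.single 2 1 + Finsupp.single 2 1 = exponent a b (c + 2) := by
    ext i; fin_cases i <;> simp [exponent]
  rw [e0, e1, e2] at h
  have v : exponent a b c 0 = a ∧ exponent a b c 1 = b ∧ exponent a b c 2 = c := by simp [exponent]
  simp only [Finsupp.add_apply, Finsupp.single_eq_same, v, Nat.cast_add, Nat.cast_one] at h
  linear_combination h

/-- The coefficients of a homogeneous polynomial of degree `l` at the monomials whose degree in the
last variable is at most `1`. -/
def leadingCoeffs (l : ℕ) : MvPolynomial (Fin 3) ℝ →ₗ[ℝ] (Fin (l + 1) ⊕ Fin l → ℝ) :=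
  LinearMap.pi fun s => MvPolynomial.lcoeff ℝ
    (s.elim (fun j : Fin (l + 1) => exponent j (l - j) 0) fun j : Fin l => exponent j (l - 1 - j) 1)

/-- The recursion can be divided by `(c + 2)(c + 1)`, so the coefficients with last exponent 0 or 1
determine all the others. -/
lemma eq_zero_of_leadingCoeffs {l : ℕ} {p : MvPolynomial (Fin 3) ℝ}
    (hp : p ∈ harmonicPolynomial l) (h : leadingCoeffs l p = 0) : p = 0 := by
  have hdeg : ∀ a b c, a + b + c ≠ l → p.coeff (exponent a b c) = 0 := fun a b c hne =>
    hp.1.coeff_eq_zero (by rwa [degree_exponent])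
  have key : ∀ c a b, p.coeff (exponent a b c) = 0 := by
    intro c
    induction c using Nat.twoStepInduction with
    | zero =>
      intro a b
      by_cases hab : a + b = l
      · have := congrFun h (Sum.inl ⟨a, by omega⟩)
        have hb : b = l - a := by omega
        simpa [leadingCoeffs, hb] using this
      · exact hdeg _ _ _ (by omega)
    | one =>
      intro a b
      by_cases hab : a + b + 1 = l
      · have := congrFun h (Sum.inr ⟨a, by omega⟩)
        have hb : b = l - 1 - a := by omega
        simpa [leadingCoeffs, hb] using this
      · exact hdeg _ _ _ (by omega)
    | more c ih _ =>
      intro a b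
      have := coeff_harmonic hp a b c
      rw [ih, ih, zero_mul, zero_mul, zero_add, zero_add] at this
      exact (mul_eq_zero.1 this).resolve_right (by positivity)
  ext m
  rw [← exponent_eta m, key, MvPolynomial.coeff_zero]

lemma leadingCoeffs_injective (l : ℕ) :
    Function.Injective ((leadingCoeffs l).domRestrict (harmonicPolynomial l)) := by
  rw [injective_iff_map_eq_zero]
  intro p hp
  exact Subtype.ext (eq_zero_of_leadingCoeffs p.2 hp)

instance (l : ℕ) : FiniteDimensional ℝ (harmonicPolynomial l) :=
  FiniteDimensional.of_injective _ (leadingCoeffs_injective l)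

lemma finrank_harmonicPolynomial_le (l : ℕ) :
    Module.finrank ℝ (harmonicPolynomial l) ≤ 2 * l + 1 := by
  refine (LinearMap.finrank_le_finrank_of_injective (leadingCoeffs_injective l)).trans ?_
  rw [Module.finrank_fintype_fun_eq_card, Fintype.card_sum, Fintype.card_fin, Fintype.card_fin]
  omega

/-! ### Orthogonal substitutions preserve harmonicity. -/

/-- The linear substitution `p ↦ p ∘ A`. -/
def linearSubst (A : Matrix (Fin 3) (Fin 3) ℝ) :
    MvPolynomial (Fin 3) ℝ →ₐ[ℝ] MvPolynomial (Fin 3) ℝ :=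
  MvPolynomial.bind₁ fun i => ∑ j, MvPolynomial.C (A i j) * MvPolynomial.X j

lemma eval_linearSubst (A : Matrix (Fin 3) (Fin 3) ℝ) (p : MvPolynomial (Fin 3) ℝ)
    (x : Fin 3 → ℝ) :
    MvPolynomial.eval x (linearSubst A p) = MvPolynomial.eval (A.mulVec x) p := by
  change MvPolynomial.eval₂Hom (RingHom.id ℝ) x (MvPolynomial.bind₁ _ p) = _
  rw [MvPolynomial.eval₂Hom_bind₁]
  congr 2
  ext i
  simp [Matrix.mulVec, dotProduct]

/-- The chain rule, by induction on the polynomial. -/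
lemma pderiv_linearSubst (A : Matrix (Fin 3) (Fin 3) ℝ) (p : MvPolynomial (Fin 3) ℝ) (i : Fin 3) :
    MvPolynomial.pderiv i (linearSubst A p)
      = ∑ j, MvPolynomial.C (A j i) * linearSubst A (MvPolynomial.pderiv j p) := by
  induction p using MvPolynomial.induction_on with
  | C a => simp [linearSubst]
  | add p q hp hq => simp only [map_add, hp, hq, mul_add, Finset.sum_add_distrib]
  | mul_X p n hp =>
    have hX : MvPolynomial.pderiv i (linearSubst A (MvPolynomial.X n)) = MvPolynomial.C (A n i) := by
      simp [linearSubst, MvPolynomial.pderiv_X, Pi.single_apply]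
    have hd : ∀ j, MvPolynomial.pderiv j (MvPolynomial.X n : MvPolynomial (Fin 3) ℝ)
        = if j = n then 1 else 0 := by
      intro j
      rw [MvPolynomial.pderiv_X, Pi.single_apply]
      simp only [eq_comm]
    simp only [map_mul, Derivation.leibniz, hX, hp, smul_eq_mul, hd, map_add, mul_add,
      Finset.sum_add_distrib, Finset.mul_sum]
    congr 1
    · simp only [apply_ite (linearSubst A), map_one, map_zero, mul_ite, mul_one, mul_zero,
        Finset.sum_ite_eq', Finset.mem_univ, if_true]
      simp [mul_comm]
    · exact Finset.sum_congr rfl fun j _ => by ring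

/-- By the chain rule the second derivatives are contracted with `A Aᵀ = 1`, which leaves the
Laplacian. -/
lemma linearSubst_mem {A : Matrix (Fin 3) (Fin 3) ℝ} (hA : A * A.transpose = 1) {l : ℕ}
    {p : MvPolynomial (Fin 3) ℝ} (hp : p ∈ harmonicPolynomial l) :
    linearSubst A p ∈ harmonicPolynomial l := by
  constructor
  · have := hp.1.aeval (S := ℝ) (n := 1)
      (fun i => ∑ j, MvPolynomial.C (A i j) * MvPolynomial.X j) fun i =>
        MvPolynomial.IsHomogeneous.sum _ _ _ fun j _ => MvPolynomial.isHomogeneous_C_mul_X _ _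
    rwa [one_mul] at this
  · have h : ∀ i, MvPolynomial.pderiv i (MvPolynomial.pderiv i (linearSubst A p))
        = ∑ j, ∑ k, MvPolynomial.C (A j i * A k i)
          * linearSubst A (MvPolynomial.pderiv k (MvPolynomial.pderiv j p)) := by
      intro i
      rw [pderiv_linearSubst, map_sum]
      refine Finset.sum_congr rfl fun j _ => ?_
      rw [MvPolynomial.pderiv_C_mul, pderiv_linearSubst, Finset.mul_sum]
      exact Finset.sum_congr rfl fun k _ => by rw [MvPolynomial.C_mul, mul_assoc]
    have h' : ∀ j k, ∑ i, A j i * A k i = if j = k then 1 else 0 := fun j k => by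
      have := congrFun (congrFun hA j) k
      rwa [Matrix.mul_apply, Matrix.one_apply] at this
    simp only [h]
    rw [Finset.sum_comm]
    have : ∀ j, ∑ i, ∑ k, MvPolynomial.C (A j i * A k i)
          * linearSubst A (MvPolynomial.pderiv k (MvPolynomial.pderiv j p))
        = linearSubst A (MvPolynomial.pderiv j (MvPolynomial.pderiv j p)) := by
      intro j
      rw [Finset.sum_comm]
      simp only [← Finset.sum_mul, ← map_sum, h']
      simp [apply_ite, ite_mul]
    simp only [this, ← map_sum, hp.2, map_zero]

/-! ### Measure, continuity and orthonormal systems on the sphere. -/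

lemma area_eq : area = 4 * Real.pi := by
  rw [area, surfaceMeasure, Measure.toSphere_real_apply_univ, Measure.real,
    EuclideanSpace.volume_ball_fin_three, finrank_euclideanSpace, Fintype.card_fin]
  rw [ENNReal.ofReal_one, one_pow, one_mul, ENNReal.toReal_ofReal (by positivity)]
  push_cast
  ring

instance : IsFiniteMeasure surfaceMeasure := by unfold surfaceMeasure; infer_instance

lemma continuous_eval_sphere (p : MvPolynomial (Fin 3) ℝ) :
    Continuous fun x : S2 => MvPolynomial.eval (fun i => x.1 i) p :=
  (MvPolynomial.continuous_eval p).comp (by fun_prop)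

lemma IsSphericalPolynomial.continuous {t : ℕ} {f : S2 → ℝ} (hf : IsSphericalPolynomial t f) :
    Continuous f := by
  obtain ⟨p, -, hp⟩ := hf
  rw [funext hp]
  exact continuous_eval_sphere p

lemma IsSphericalHarmonic.isSphericalPolynomial {l t : ℕ} (hl : l ≤ t) {f : S2 → ℝ}
    (hf : IsSphericalHarmonic l f) : IsSphericalPolynomial t f := by
  obtain ⟨p, hp, -, hpf⟩ := hf
  exact ⟨p, hp.totalDegree_le.trans hl, hpf⟩

lemma IsSphericalHarmonic.continuous {l : ℕ} {f : S2 → ℝ} (hf : IsSphericalHarmonic l f) :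
    Continuous f :=
  (hf.isSphericalPolynomial le_rfl).continuous

lemma integrable_of_continuous {f : S2 → ℝ} (hf : Continuous f) : Integrable f surfaceMeasure :=
  hf.integrable_of_hasCompactSupport (HasCompactSupport.of_compactSpace f)

lemma integral_sum_mul_of_orthonormal {ι : Type*} [Fintype ι] [DecidableEq ι] {y : ι → S2 → ℝ}
    (hc : ∀ k, Continuous (y k))
    (ho : ∀ k k', ∫ x, y k x * y k' x ∂surfaceMeasure = if k = k' then 1 else 0)
    (c : ι → ℝ) (j : ι) : ∫ x, (∑ k, c k * y k x) * y j x ∂surfaceMeasure = c j := by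
  simp only [Finset.sum_mul, mul_assoc]
  rw [integral_finsetSum]
  swap
  · exact fun k _ => (integrable_of_continuous ((hc k).mul (hc j))).const_mul (c k)
  simp [integral_const_mul, ho]

lemma linearIndependent_of_orthonormal {ι : Type*} [Fintype ι] [DecidableEq ι] {y : ι → S2 → ℝ}
    (hc : ∀ k, Continuous (y k))
    (ho : ∀ k k', ∫ x, y k x * y k' x ∂surfaceMeasure = if k = k' then 1 else 0) :
    LinearIndependent ℝ y := by
  rw [Fintype.linearIndependent_iff]
  intro c h j
  rw [← integral_sum_mul_of_orthonormal hc ho c j]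
  have : ∀ x, ∑ k, c k * y k x = 0 := fun x => by simpa using congrFun h x
  simp [this]

/-- The restriction of polynomials to the sphere. -/
def sphereRestrict : MvPolynomial (Fin 3) ℝ →ₗ[ℝ] (S2 → ℝ) where
  toFun p x := MvPolynomial.eval (fun i => x.1 i) p
  map_add' p q := by ext x; simp
  map_smul' c p := by ext x; simp

lemma isSphericalHarmonic_iff {l : ℕ} {f : S2 → ℝ} :
    IsSphericalHarmonic l f ↔ f ∈ (harmonicPolynomial l).map sphereRestrict := by
  constructor
  · rintro ⟨p, hp, hp', hf⟩
    exact ⟨p, ⟨hp, hp'⟩, (funext hf).symm⟩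
  · rintro ⟨p, hp, rfl⟩
    exact ⟨p, hp.1, hp.2, fun _ => rfl⟩

/-- A dimension count: `2l + 1` independent elements fill a space of dimension at most `2l + 1`. -/
lemma IsSphericalHarmonic.exists_eq_sum {l : ℕ} {y : Fin (2 * l + 1) → S2 → ℝ}
    (hy : ∀ k, IsSphericalHarmonic l (y k)) (hl : LinearIndependent ℝ y)
    {f : S2 → ℝ} (hf : IsSphericalHarmonic l f) :
    ∃ c : Fin (2 * l + 1) → ℝ, ∀ x, f x = ∑ k, c k * y k x := by
  have hle : Submodule.span ℝ (Set.range y) ≤ (harmonicPolynomial l).map sphereRestrict := by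
    rw [Submodule.span_le]
    rintro _ ⟨k, rfl⟩
    exact isSphericalHarmonic_iff.1 (hy k)
  have heq := Submodule.eq_of_le_of_finrank_le hle (by
    rw [finrank_span_eq_card hl, Fintype.card_fin]
    exact (Submodule.finrank_map_le _ _).trans (finrank_harmonicPolynomial_le l))
  have hf' := isSphericalHarmonic_iff.1 hf
  rw [← heq, Submodule.mem_span_range_iff_exists_fun] at hf'
  obtain ⟨c, hc⟩ := hf'
  exact ⟨c, fun x => by simp [← hc]⟩

/-! ### Isometries and the invariance of the kernel. -/

/-- The action of a linear isometry on the sphere. -/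
def sphereMap (T : EuclideanSpace ℝ (Fin 3) ≃ₗᵢ[ℝ] EuclideanSpace ℝ (Fin 3)) (x : S2) : S2 :=
  ⟨T x.1, by simp⟩

/-- Surface measure is a multiple of the volume of the cone over a set; an isometry maps cones to
cones and preserves volume. -/
lemma measurePreserving_sphereMap
    (T : EuclideanSpace ℝ (Fin 3) ≃ₗᵢ[ℝ] EuclideanSpace ℝ (Fin 3)) :
    MeasurePreserving (sphereMap T) surfaceMeasure surfaceMeasure := by
  have hc : Continuous (sphereMap T) := by unfold sphereMap; fun_prop
  refine ⟨hc.measurable, ?_⟩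
  ext s hs
  rw [Measure.map_apply hc.measurable hs, surfaceMeasure, Measure.toSphere_apply' _ hs,
    Measure.toSphere_apply' _ (hc.measurable hs)]
  congr 1
  have : Set.Ioo (0 : ℝ) 1 • (Subtype.val '' (sphereMap T ⁻¹' s))
      = T ⁻¹' (Set.Ioo (0 : ℝ) 1 • (Subtype.val '' s)) := by
    ext v
    simp only [Set.mem_smul, Set.mem_image, Set.mem_preimage]
    constructor
    · rintro ⟨r, hr, _, ⟨x, hx, rfl⟩, rfl⟩
      exact ⟨r, hr, _, ⟨_, hx, rfl⟩, by simp [sphereMap]⟩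
    · rintro ⟨r, hr, _, ⟨x, hx, rfl⟩, h⟩
      refine ⟨r, hr, _, ⟨sphereMap T.symm x, ?_, rfl⟩, ?_⟩
      · simpa [sphereMap] using hx
      · apply T.injective
        simp [sphereMap, ← h]
  rw [this]
  exact (T.measurePreserving).measure_preimage_emb T.toHomeomorph.measurableEmbedding _

lemma IsSphericalHarmonic.comp_sphereMap {l : ℕ} {f : S2 → ℝ} (hf : IsSphericalHarmonic l f)
    (T : EuclideanSpace ℝ (Fin 3) ≃ₗᵢ[ℝ] EuclideanSpace ℝ (Fin 3)) :
    IsSphericalHarmonic l fun x => f (sphereMap T x) := by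
  obtain ⟨p, hp, hp', hpf⟩ := hf
  set A : Matrix (Fin 3) (Fin 3) ℝ := Matrix.of fun i j => T (EuclideanSpace.single j 1) i with hA
  have hAx : ∀ x : EuclideanSpace ℝ (Fin 3), A.mulVec (fun i => x i) = fun i => T x i := by
    intro x
    ext i
    have hx : x = ∑ j, x j • EuclideanSpace.single j (1 : ℝ) := by
      ext i
      simp [Pi.single_apply]
    conv_rhs => rw [hx, map_sum]
    simp [Matrix.mulVec, dotProduct, hA, mul_comm]
  have hAA : A.transpose * A = 1 := by
    ext j k
    have h := T.inner_map_map (EuclideanSpace.single j (1 : ℝ)) (EuclideanSpace.single k 1)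
    rw [EuclideanSpace.inner_single_left] at h
    simp only [PiLp.inner_apply, map_one, one_mul] at h
    rw [Matrix.mul_apply, Matrix.one_apply]
    simpa [hA, mul_comm, Pi.single_apply] using h
  have hm := linearSubst_mem (mul_eq_one_comm.1 hAA) (p := p) ⟨hp, hp'⟩
  refine ⟨linearSubst A p, hm.1, hm.2, fun x => ?_⟩
  rw [eval_linearSubst, hAx]
  exact hpf _

/-- The reproducing kernel of the spherical harmonics of degree `l` is invariant under linear
isometries. -/
lemma sum_mul_sphereMap {l : ℕ} {y : Fin (2 * l + 1) → S2 → ℝ}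
    (hy : ∀ k, IsSphericalHarmonic l (y k))
    (ho : ∀ k k', ∫ x, y k x * y k' x ∂surfaceMeasure = if k = k' then 1 else 0)
    (T : EuclideanSpace ℝ (Fin 3) ≃ₗᵢ[ℝ] EuclideanSpace ℝ (Fin 3)) (x z : S2) :
    ∑ k, y k (sphereMap T x) * y k (sphereMap T z) = ∑ k, y k x * y k z := by
  have hc := fun k => (hy k).continuous
  have hl := linearIndependent_of_orthonormal hc ho
  choose U hU using fun k =>
    IsSphericalHarmonic.exists_eq_sum hy hl ((hy k).comp_sphereMap T)
  -- `U` is the matrix of `f ↦ f ∘ T` in the basis `y`; it is orthogonal because `T` preserves the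
  -- `L²` inner product.
  have hUU : (Matrix.of U : Matrix (Fin (2 * l + 1)) (Fin (2 * l + 1)) ℝ) * (Matrix.of U).transpose = 1 := by
    ext k m
    have h := (measurePreserving_sphereMap T).integral_comp
      (Continuous.measurableEmbedding (by unfold sphereMap; fun_prop) (by
        intro a b hab
        apply Subtype.ext
        apply T.injective
        exact congrArg Subtype.val hab)) (fun x => y k x * y m x)
    rw [ho] at h
    rw [Matrix.mul_apply, Matrix.one_apply, ← h]
    simp only [hU m, Finset.mul_sum, mul_left_comm (y k (sphereMap T _))]
    rw [integral_finsetSum]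
    swap
    · exact fun j _ => (integrable_of_continuous
        (((hy k).comp_sphereMap T).continuous.mul (hc j))).const_mul (U m j)
    refine Finset.sum_congr rfl fun j _ => ?_
    rw [integral_const_mul, Matrix.transpose_apply, Matrix.of_apply, Matrix.of_apply, mul_comm,
      ← integral_sum_mul_of_orthonormal hc ho (U k) j]
    simp only [hU k]
  -- The kernel sums over the row index of `U`, so it needs `Uᵀ U = 1`.
  have hUU_comm := mul_eq_one_comm.1 hUU
  have hUU' : ∀ i j, ∑ k, U k i * U k j = if i = j then 1 else 0 := fun i j => by
    have := congrFun (congrFun hUU_comm i) j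
    rwa [Matrix.mul_apply, Matrix.one_apply] at this
  simp only [hU, Finset.sum_mul_sum]
  rw [Finset.sum_comm]
  refine Finset.sum_congr rfl fun i _ => ?_
  rw [Finset.sum_comm]
  have : ∀ j, ∑ k, U k i * y i x * (U k j * y j z)
      = (∑ k, U k i * U k j) * (y i x * y j z) := fun j => by
    rw [Finset.sum_mul]
    exact Finset.sum_congr rfl fun k _ => by ring
  simp [this, hUU']

/-! ### Trigonometric polynomials and Parseval. -/

lemma integral_exp_two_mul_int (n : ℤ) :
    ∫ s in (0 : ℝ)..2 * Real.pi, Complex.exp (2 * n * Complex.I * s)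
      = if n = 0 then (2 * Real.pi : ℂ) else 0 := by
  split_ifs with h
  · simp [h]
  · have hc : (2 * n * Complex.I : ℂ) ≠ 0 := by simp [h]
    rw [integral_exp_mul_complex hc, Complex.ofReal_zero, div_eq_zero_iff]
    left
    have : (2 * n * Complex.I * ((2 * Real.pi : ℝ) : ℂ))
        = (2 * n : ℤ) * (2 * Real.pi * Complex.I) := by
      push_cast
      ring
    rw [this, Complex.exp_int_mul_two_pi_mul_I]
    simp

/-- Parseval's identity for exponential sums with even frequencies. -/
lemma integral_norm_sq_exp_sum (m : ℕ) (c : ℕ → ℂ) :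
    ∫ s in (0 : ℝ)..2 * Real.pi,
        ‖∑ j ∈ Finset.range m, c j * Complex.exp (2 * j * Complex.I * s)‖ ^ 2
      = 2 * Real.pi * ∑ j ∈ Finset.range m, ‖c j‖ ^ 2 := by
  apply Complex.ofReal_injective
  rw [← intervalIntegral.integral_ofReal]
  have h : ∀ s : ℝ, ((‖∑ j ∈ Finset.range m, c j * Complex.exp (2 * j * Complex.I * s)‖ ^ 2 : ℝ) : ℂ)
      = ∑ j ∈ Finset.range m, ∑ k ∈ Finset.range m, c j * (starRingEnd ℂ) (c k)
        * Complex.exp (2 * ((j : ℤ) - (k : ℤ) : ℤ) * Complex.I * s) := by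
    intro s
    push_cast
    rw [← Complex.mul_conj', map_sum, Finset.sum_mul_sum]
    refine Finset.sum_congr rfl fun j _ => Finset.sum_congr rfl fun k _ => ?_
    rw [map_mul, ← Complex.exp_conj, mul_mul_mul_comm, ← Complex.exp_add]
    congr 2
    simp [Complex.conj_ofNat]
    ring
  simp only [h]
  rw [intervalIntegral.integral_finsetSum fun j _ =>
    Continuous.intervalIntegrable (by fun_prop) _ _]
  rw [Complex.ofReal_mul, Complex.ofReal_sum, Finset.mul_sum]
  refine Finset.sum_congr rfl fun j hj => ?_
  rw [intervalIntegral.integral_finsetSum fun k _ =>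
    Continuous.intervalIntegrable (by fun_prop) _ _]
  simp only [intervalIntegral.integral_const_mul, integral_exp_two_mul_int, sub_eq_zero,
    Nat.cast_inj]
  simp only [mul_ite, mul_zero, Finset.sum_ite_eq, hj, if_true]
  push_cast
  rw [← Complex.mul_conj']
  ring

/-- On a great circle, a homogeneous polynomial of degree `l` is a
trigonometric polynomial of degree at most `l`. -/
lemma exists_eval_circle {l : ℕ} {p : MvPolynomial (Fin 3) ℝ} (hp : p.IsHomogeneous l)
    (x e : Fin 3 → ℝ) :
    ∃ q : ℕ → ℂ, ∀ s : ℝ,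
      ((MvPolynomial.eval (fun i => Real.cos s * x i + Real.sin s * e i) p : ℝ) : ℂ)
        = Complex.exp (-l * Complex.I * s)
          * ∑ j ∈ Finset.range (l + 1), q j * Complex.exp (2 * j * Complex.I * s) := by
  -- With `E = exp(is)`, `cos s · x + sin s · e = E⁻¹ (E² (x - ie)/2 + (x + ie)/2)`. Homogeneity
  -- pulls out `E⁻ˡ` and leaves a polynomial of degree at most `l` in `E²`.
  set f : Fin 3 → Polynomial ℂ := fun i =>
    Polynomial.C ((x i - Complex.I * e i) / 2) * Polynomial.X
      + Polynomial.C ((x i + Complex.I * e i) / 2) with hf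
  set P : MvPolynomial (Fin 3) ℂ := p.map Complex.ofRealHom
  have hP : P.IsHomogeneous l := hp.map _
  set Q : Polynomial ℂ := MvPolynomial.aeval f P with hQ
  have hdeg : Q.natDegree < l + 1 := by
    have := MvPolynomial.aeval_natDegree_le (m := l) (n := 1) P hP.totalDegree_le f
      (fun i => Polynomial.natDegree_linear_le)
    rw [← hQ] at this
    omega
  refine ⟨Q.coeff, fun s => ?_⟩
  have hexp : ∀ j : ℕ, Complex.exp (2 * j * Complex.I * s) = Complex.exp (2 * Complex.I * s) ^ j := by
    intro j
    rw [← Complex.exp_nat_mul]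
    congr 1
    ring
  simp only [hexp]
  rw [← Polynomial.eval_eq_sum_range' hdeg]
  have h1 : Q.eval (Complex.exp (2 * Complex.I * s))
      = MvPolynomial.eval (fun i => Complex.exp (Complex.I * s) *
          ((Real.cos s * x i + Real.sin s * e i : ℝ) : ℂ)) P := by
    rw [hQ, ← Polynomial.coe_evalRingHom, MvPolynomial.map_aeval]
    rw [MvPolynomial.eval, MvPolynomial.coe_eval₂Hom, MvPolynomial.coe_eval₂Hom]
    congr 1
    · ext1 c
      simp
    · funext i
      have h2 : Complex.exp (2 * Complex.I * s)
          = Complex.exp (Complex.I * s) * Complex.exp (Complex.I * s) := by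
        rw [← Complex.exp_add]
        congr 1
        ring
      have h3 : Complex.exp (Complex.I * s) * Complex.exp (-(Complex.I * s)) = 1 := by
        rw [← Complex.exp_add, add_neg_cancel, Complex.exp_zero]
      simp only [hf, Polynomial.coe_evalRingHom, Polynomial.eval_add, Polynomial.eval_mul,
        Polynomial.eval_C, Polynomial.eval_X]
      push_cast
      rw [h2, Complex.cos, Complex.sin, mul_comm (s : ℂ) Complex.I, neg_mul,
        mul_comm (s : ℂ) Complex.I]
      linear_combination (-(x i + Complex.I * e i) / 2) * h3
  have h4 : MvPolynomial.eval (fun i => Complex.exp (Complex.I * s) *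
          ((Real.cos s * x i + Real.sin s * e i : ℝ) : ℂ)) P
      = Complex.exp (Complex.I * s) ^ l *
        MvPolynomial.eval (fun i => ((Real.cos s * x i + Real.sin s * e i : ℝ) : ℂ)) P := by
    rw [MvPolynomial.eval_eq', MvPolynomial.eval_eq', Finset.mul_sum]
    refine Finset.sum_congr rfl fun d hd => ?_
    have hd' : ∑ i, d i = l := by
      rw [← hP (MvPolynomial.mem_support_iff.1 hd)]
      simp [Finsupp.weight_apply, Finsupp.sum_fintype]
    simp only [mul_pow, Finset.prod_mul_distrib, Finset.prod_pow_eq_pow_sum, hd']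
    ring
  have h5 : MvPolynomial.eval (fun i => ((Real.cos s * x i + Real.sin s * e i : ℝ) : ℂ)) P
      = ((MvPolynomial.eval (fun i => Real.cos s * x i + Real.sin s * e i) p : ℝ) : ℂ) := by
    have := MvPolynomial.map_eval Complex.ofRealHom (fun i => Real.cos s * x i + Real.sin s * e i) p
    exact this.symm
  rw [h1, h4, h5, ← mul_assoc, ← Complex.exp_nat_mul, ← Complex.exp_add]
  have : (-l * Complex.I * s + l * (Complex.I * s) : ℂ) = 0 := by ring
  rw [this, Complex.exp_zero, one_mul]

/-- The mean square of an increment of a trigonometric polynomial of degree `l`. -/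
lemma integral_sq_increment_le {l : ℕ} {h : ℝ → ℝ} {q : ℕ → ℂ}
    (hq : ∀ s : ℝ, (h s : ℂ) = Complex.exp (-l * Complex.I * s)
          * ∑ j ∈ Finset.range (l + 1), q j * Complex.exp (2 * j * Complex.I * s)) (s : ℝ) :
    ∫ θ in (0 : ℝ)..2 * Real.pi, (h (θ + s) - h θ) ^ 2
      ≤ (l * s) ^ 2 * ∫ θ in (0 : ℝ)..2 * Real.pi, h θ ^ 2 := by
  have hn : ∀ θ : ℝ, ‖Complex.exp (-l * Complex.I * θ)‖ = 1 := fun θ => by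
    rw [Complex.norm_exp]
    simp
  have h1 : ∀ θ, h θ ^ 2
      = ‖∑ j ∈ Finset.range (l + 1), q j * Complex.exp (2 * j * Complex.I * θ)‖ ^ 2 := by
    intro θ
    rw [← sq_abs, ← Real.norm_eq_abs, ← Complex.norm_real, hq, norm_mul, hn, one_mul]
  -- The shift multiplies the term of frequency `2j - l` by `exp(i(2j - l)s)`, which is within
  -- `l|s|` of 1.
  have h2 : ∀ θ, (h (θ + s) - h θ) ^ 2
      = ‖∑ j ∈ Finset.range (l + 1), (q j * (Complex.exp (Complex.I * ((2 * j - l) * s : ℝ)) - 1))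
          * Complex.exp (2 * j * Complex.I * θ)‖ ^ 2 := by
    intro θ
    rw [← sq_abs, ← Real.norm_eq_abs, ← Complex.norm_real, Complex.ofReal_sub, hq, hq]
    have : Complex.exp (-l * Complex.I * (θ + s : ℝ))
          * ∑ j ∈ Finset.range (l + 1), q j * Complex.exp (2 * j * Complex.I * (θ + s : ℝ))
        - Complex.exp (-l * Complex.I * θ)
          * ∑ j ∈ Finset.range (l + 1), q j * Complex.exp (2 * j * Complex.I * θ)
        = Complex.exp (-l * Complex.I * θ) *
          ∑ j ∈ Finset.range (l + 1), (q j * (Complex.exp (Complex.I * ((2 * j - l) * s : ℝ)) - 1))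
          * Complex.exp (2 * j * Complex.I * θ) := by
      rw [Finset.mul_sum, Finset.mul_sum, Finset.mul_sum, ← Finset.sum_sub_distrib]
      refine Finset.sum_congr rfl fun j _ => ?_
      have e : Complex.exp (-l * Complex.I * (θ + s : ℝ)) * Complex.exp (2 * j * Complex.I * (θ + s : ℝ))
          = Complex.exp (-l * Complex.I * θ) * Complex.exp (Complex.I * ((2 * j - l) * s : ℝ))
            * Complex.exp (2 * j * Complex.I * θ) := by
        rw [← Complex.exp_add, ← Complex.exp_add, ← Complex.exp_add]
        congr 1
        push_cast
        ring
      linear_combination q j * e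
    rw [this, norm_mul, hn, one_mul]
  simp only [h1, h2, integral_norm_sq_exp_sum]
  rw [mul_left_comm]
  refine mul_le_mul_of_nonneg_left ?_ (by positivity)
  rw [Finset.mul_sum]
  refine Finset.sum_le_sum fun j hj => ?_
  rw [norm_mul, mul_pow, mul_comm]
  refine mul_le_mul_of_nonneg_right ?_ (by positivity)
  rw [← sq_abs (l * s)]
  refine pow_le_pow_left₀ (norm_nonneg _) (Real.norm_exp_I_mul_ofReal_sub_one_le.trans ?_) 2
  rw [Real.norm_eq_abs, abs_mul, abs_mul]
  refine mul_le_mul_of_nonneg_right ?_ (abs_nonneg _)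
  have : (j : ℝ) ≤ l := by exact_mod_cast Nat.lt_succ_iff.1 (Finset.mem_range.1 hj)
  rw [Nat.abs_cast, abs_le]
  have := j.cast_nonneg (α := ℝ)
  constructor <;> linarith

/-! ### Great circles and their reflections. -/

lemma inner_self_sphere (x : S2) : inner ℝ x.1 x.1 = 1 := by
  rw [real_inner_self_eq_norm_sq, norm_eq_of_mem_sphere x, one_pow]

/-- The point with parameter `s` on the great circle through `x` and `e`. -/
def circlePoint {x e : S2} (h : inner ℝ x.1 e.1 = 0) (s : ℝ) : S2 :=
  ⟨Real.cos s • x.1 + Real.sin s • e.1, by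
    rw [mem_sphere_zero_iff_norm, ← sq_eq_sq₀ (norm_nonneg _) zero_le_one,
      ← real_inner_self_eq_norm_sq]
    simp only [inner_add_left, inner_add_right, real_inner_smul_left, real_inner_smul_right,
      inner_self_sphere, h, real_inner_comm x.1 e.1]
    linear_combination Real.cos_sq_add_sin_sq s⟩

lemma circlePoint_zero {x e : S2} (h : inner ℝ x.1 e.1 = 0) : circlePoint h 0 = x := by
  apply Subtype.ext
  simp [circlePoint]

/-- Gram–Schmidt: `e` is the normalized component of `y` orthogonal to `x`. -/
lemma exists_circlePoint_eq (x y : S2) :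
    ∃ (e : S2) (h : inner ℝ x.1 e.1 = 0), circlePoint h (geodist x y) = y := by
  have hxy : |inner ℝ x.1 y.1| ≤ 1 := by
    simpa using abs_real_inner_le_norm x.1 y.1
  have hcos : Real.cos (geodist x y) = inner ℝ x.1 y.1 :=
    Real.cos_arccos (abs_le.1 hxy).1 (abs_le.1 hxy).2
  set c := inner ℝ x.1 y.1 with hc
  have hv : inner ℝ x.1 (y.1 - c • x.1) = 0 := by
    rw [inner_sub_right, real_inner_smul_right, inner_self_sphere, mul_one, sub_self]
  have hvn : ‖y.1 - c • x.1‖ ^ 2 = 1 - c ^ 2 := by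
    rw [← real_inner_self_eq_norm_sq]
    simp only [inner_sub_left, inner_sub_right, real_inner_smul_left, real_inner_smul_right,
      inner_self_sphere, real_inner_comm x.1 y.1, ← hc]
    ring
  have hsin : Real.sin (geodist x y) = ‖y.1 - c • x.1‖ := by
    rw [geodist, Real.sin_arccos, ← hvn, Real.sqrt_sq (norm_nonneg _)]
  -- Here `y = ±x`, and any unit vector orthogonal to `x` serves as `e`.
  by_cases h0 : y.1 - c • x.1 = 0
  · obtain ⟨e, he, hxe⟩ : ∃ e : EuclideanSpace ℝ (Fin 3), ‖e‖ = 1 ∧ inner ℝ x.1 e = 0 := by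
      have hne : (ℝ ∙ x.1)ᗮ ≠ ⊥ := by
        intro hbot
        have h1 := Submodule.finrank_add_finrank_orthogonal (ℝ ∙ x.1)
        have h2 : Module.finrank ℝ (ℝ ∙ x.1) ≤ 1 := by
          simpa using finrank_span_le_card (R := ℝ) ({x.1} : Set (EuclideanSpace ℝ (Fin 3)))
        rw [hbot, finrank_bot, finrank_euclideanSpace, Fintype.card_fin] at h1
        omega
      obtain ⟨v, hv, hv0⟩ := Submodule.exists_mem_ne_zero_of_ne_bot hne
      refine ⟨‖v‖⁻¹ • v, norm_smul_inv_norm hv0, ?_⟩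
      rw [real_inner_smul_right, Submodule.mem_orthogonal_singleton_iff_inner_right.1 hv, mul_zero]
    refine ⟨⟨e, by simpa using he⟩, hxe, Subtype.ext ?_⟩
    rw [circlePoint]
    simp only [hcos, hsin, h0, norm_zero, zero_smul, add_zero]
    exact (sub_eq_zero.1 h0).symm
  · have hne := norm_ne_zero_iff.2 h0
    refine ⟨⟨‖y.1 - c • x.1‖⁻¹ • (y.1 - c • x.1), ?_⟩, ?_, Subtype.ext ?_⟩
    · rw [mem_sphere_zero_iff_norm]
      exact norm_smul_inv_norm h0
    · rw [real_inner_smul_right, hv, mul_zero]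
    · rw [circlePoint]
      simp only [hcos, hsin, smul_smul, mul_inv_cancel₀ hne, one_smul]
      abel

lemma exists_isometry_circlePoint {x e : S2} (h : inner ℝ x.1 e.1 = 0) (β : ℝ) :
    ∃ T : EuclideanSpace ℝ (Fin 3) ≃ₗᵢ[ℝ] EuclideanSpace ℝ (Fin 3),
      ∀ φ, sphereMap T (circlePoint h φ) = circlePoint h (β - φ) := by
  obtain ⟨α, rfl⟩ : ∃ α, β = 2 * α := ⟨β / 2, by ring⟩
  -- The point at angle `α + π/2`: reflection in the plane orthogonal to `u` fixes the point at
  -- angle `α = β/2` and so reverses the circle about it.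
  set u : EuclideanSpace ℝ (Fin 3) := -Real.sin α • x.1 + Real.cos α • e.1 with hu
  have hun : ‖u‖ ^ 2 = 1 := by
    rw [← real_inner_self_eq_norm_sq, hu]
    simp only [inner_add_left, inner_add_right, real_inner_smul_left, real_inner_smul_right,
      inner_self_sphere, h, real_inner_comm x.1 e.1]
    linear_combination Real.cos_sq_add_sin_sq α
  refine ⟨(ℝ ∙ u)ᗮ.reflection, fun φ => Subtype.ext ?_⟩
  have hin : inner ℝ u (circlePoint h φ).1 = Real.sin (φ - α) := by
    rw [hu, circlePoint, Real.sin_sub]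
    simp only [inner_add_left, inner_add_right, real_inner_smul_left, real_inner_smul_right,
      inner_self_sphere, h, real_inner_comm x.1 e.1]
    ring
  change (ℝ ∙ u)ᗮ.reflection (circlePoint h φ).1 = _
  rw [Submodule.reflection_orthogonal_apply, Submodule.reflection_singleton_apply, hin]
  have hun' : ((‖u‖ : ℝ) : ℝ) ^ 2 = 1 := hun
  simp only [RCLike.ofReal_real_eq_id, id_eq, hun', div_one]
  rw [circlePoint, circlePoint, hu]
  have h1 : Real.cos (2 * α - φ) = Real.cos φ + 2 * (Real.sin (φ - α) * Real.sin α) := by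
    rw [Real.cos_sub, Real.cos_two_mul, Real.sin_two_mul, Real.sin_sub]
    linear_combination (2 * Real.cos φ) * Real.sin_sq_add_cos_sq α
  have h2 : Real.sin (2 * α - φ) = Real.sin φ - 2 * (Real.sin (φ - α) * Real.cos α) := by
    rw [Real.sin_sub, Real.cos_two_mul, Real.sin_two_mul, Real.sin_sub]
    ring
  simp only [h1, h2]
  module

/-! ### The addition theorem on the diagonal and the Lipschitz bound. -/

section Kernel

variable {l : ℕ} {y : Fin (2 * l + 1) → S2 → ℝ}

/-- The addition theorem on the diagonal. -/
lemma sum_sq_eq (hy : ∀ k, IsSphericalHarmonic l (y k))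
    (ho : ∀ k k', ∫ x, y k x * y k' x ∂surfaceMeasure = if k = k' then 1 else 0) (x : S2) :
    ∑ k, y k x * y k x = (2 * l + 1) / (4 * Real.pi) := by
  -- Reflections carry any `z` to `x`, so the sum is constant; its integral is `2l + 1`.
  have hconst : ∀ z, ∑ k, y k z * y k z = ∑ k, y k x * y k x := by
    intro z
    obtain ⟨e, h, hz⟩ := exists_circlePoint_eq x z
    obtain ⟨T, hT⟩ := exists_isometry_circlePoint h (geodist x z)
    have hTz : sphereMap T z = x := by
      conv_lhs => rw [← hz]
      rw [hT, sub_self, circlePoint_zero]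
    rw [← sum_mul_sphereMap hy ho T z z, hTz]
  have hint : ∫ z, ∑ k, y k z * y k z ∂surfaceMeasure = 2 * l + 1 := by
    rw [integral_finsetSum]
    swap
    · exact fun k _ => integrable_of_continuous ((hy k).continuous.mul (hy k).continuous)
    simp [ho]
  simp only [hconst, integral_const, smul_eq_mul] at hint
  change area * _ = _ at hint
  rw [area_eq] at hint
  rw [eq_div_iff (by positivity), ← hint, mul_comm]

/-- By invariance the sum is an average over the great circle, where Parseval bounds each term and
the addition theorem evaluates the total. -/
lemma sum_sq_sub_le (hy : ∀ k, IsSphericalHarmonic l (y k))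
    (ho : ∀ k k', ∫ x, y k x * y k' x ∂surfaceMeasure = if k = k' then 1 else 0) (x z : S2) :
    ∑ k, (y k z - y k x) ^ 2 ≤ (l * geodist x z) ^ 2 * ((2 * l + 1) / (4 * Real.pi)) := by
  obtain ⟨e, h, hz⟩ := exists_circlePoint_eq x z
  set s := geodist x z
  have hcirc : Continuous fun θ => circlePoint h θ := by
    unfold circlePoint
    fun_prop
  have hcont : ∀ k, Continuous fun θ => y k (circlePoint h θ) := fun k =>
    (hy k).continuous.comp hcirc
  have hconst : ∀ θ, ∑ k, (y k (circlePoint h (θ + s)) - y k (circlePoint h θ)) ^ 2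
      = ∑ k, (y k z - y k x) ^ 2 := by
    intro θ
    -- The reflection `φ ↦ θ + s - φ` sends the points at `θ + s` and `θ` to `x` and `z`; the swap
    -- is harmless under the square.
    obtain ⟨T, hT⟩ := exists_isometry_circlePoint h (θ + s)
    have h1 := hT (θ + s)
    have h2 := hT θ
    rw [sub_self, circlePoint_zero] at h1
    rw [add_sub_cancel_left, hz] at h2
    have hexp : ∀ a b : S2, ∑ k, (y k a - y k b) ^ 2
        = ∑ k, y k a * y k a - 2 * ∑ k, y k a * y k b + ∑ k, y k b * y k b := by
      intro a b
      rw [Finset.mul_sum, ← Finset.sum_sub_distrib, ← Finset.sum_add_distrib]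
      exact Finset.sum_congr rfl fun k _ => by ring
    rw [hexp, hexp]
    simp only [← sum_mul_sphereMap hy ho T (circlePoint h _) (circlePoint h _), h1, h2,
      sum_sq_eq hy ho, mul_comm (y _ x)]
  have hle : ∀ k, ∫ θ in (0 : ℝ)..2 * Real.pi,
        (y k (circlePoint h (θ + s)) - y k (circlePoint h θ)) ^ 2
      ≤ (l * s) ^ 2 * ∫ θ in (0 : ℝ)..2 * Real.pi, y k (circlePoint h θ) ^ 2 := by
    intro k
    obtain ⟨p, hp, -, hpy⟩ := hy k
    obtain ⟨q, hq⟩ := exists_eval_circle hp (fun i => x.1 i) (fun i => e.1 i)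
    refine integral_sq_increment_le (h := fun θ => y k (circlePoint h θ)) (q := q) (fun θ => ?_) s
    rw [← hq, hpy]
    rfl
  have hsum := Finset.sum_le_sum fun k (_ : k ∈ Finset.univ) => hle k
  rw [← Finset.mul_sum, ← intervalIntegral.integral_finsetSum,
    ← intervalIntegral.integral_finsetSum] at hsum
  · simp only [hconst, sq (y _ (circlePoint h _)), sum_sq_eq hy ho,
      intervalIntegral.integral_const, sub_zero, smul_eq_mul] at hsum
    rw [mul_left_comm] at hsum
    exact le_of_mul_le_mul_left hsum (by positivity)
  · exact fun k _ => ((hcont k).pow 2).intervalIntegrable _ _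
  · exact fun k _ => ((((hcont k).comp (continuous_add_const s)).sub (hcont k)).pow
      2).intervalIntegrable _ _

end Kernel

lemma geodist_nonneg (x y : S2) : 0 ≤ geodist x y := Real.arccos_nonneg _

/-- The Lipschitz bound for a member of an orthonormal system of spherical harmonics. -/
lemma IsOrthonormalHarmonicSystem.abs_sub_le {t : ℕ} {Y : ℕ → ℕ → S2 → ℝ}
    (hY : IsOrthonormalHarmonicSystem t Y) {l k : ℕ} (hl : l ≤ t)
    (hk : k ∈ Finset.Icc 1 (2 * l + 1)) (x z : S2) :
    |Y l k z - Y l k x|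
      ≤ Real.sqrt ((2 * t + 1) / (4 * Real.pi)) * (t + 1) * geodist x z := by
  have hmem : ∀ j : Fin (2 * l + 1), (j : ℕ) + 1 ∈ Finset.Icc 1 (2 * l + 1) := fun j => by
    rw [Finset.mem_Icc]
    omega
  have h := sum_sq_sub_le (l := l) (y := fun j => Y l (j + 1))
    (fun j => hY.harmonic l hl _ (hmem j))
    (fun i j => by
      rw [hY.orthonormal l hl l hl _ (hmem i) _ (hmem j)]
      simp [Fin.ext_iff]) x z
  rw [Finset.mem_Icc] at hk
  have h1 : (Y l k z - Y l k x) ^ 2 ≤ (l * geodist x z) ^ 2 * ((2 * l + 1) / (4 * Real.pi)) := by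
    refine le_trans ?_ h
    have := Finset.single_le_sum (f := fun j : Fin (2 * l + 1) => (Y l (j + 1) z - Y l (j + 1) x) ^ 2)
      (fun j _ => sq_nonneg _) (Finset.mem_univ (⟨k - 1, by omega⟩ : Fin (2 * l + 1)))
    simpa only [Nat.sub_add_cancel hk.1] using this
  have hd := geodist_nonneg x z
  have hlt : (l : ℝ) ≤ t := by exact_mod_cast hl
  refine abs_le_of_sq_le_sq (h1.trans ?_) (by positivity)
  rw [mul_assoc, mul_pow (Real.sqrt _), Real.sq_sqrt (by positivity), mul_comm]
  gcongr
  linarith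

/-! ### The matrix of values at a point set. -/

lemma IsSphericalPolynomial.sub {t : ℕ} {f g : S2 → ℝ} (hf : IsSphericalPolynomial t f)
    (hg : IsSphericalPolynomial t g) : IsSphericalPolynomial t fun x => f x - g x := by
  obtain ⟨p, hp, hpf⟩ := hf
  obtain ⟨q, hq, hqg⟩ := hg
  exact ⟨p - q, (MvPolynomial.totalDegree_sub p q).trans (max_le hp hq), fun x => by
    simp only [hpf, hqg, map_sub]⟩

lemma IsSphericalPolynomial.sum_mul {t : ℕ} {ι : Type*} [Fintype ι] {f : ι → S2 → ℝ}
    (hf : ∀ i, IsSphericalPolynomial t (f i)) (c : ι → ℝ) :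
    IsSphericalPolynomial t fun x => ∑ i, f i x * c i := by
  choose p hp hpf using hf
  refine ⟨∑ i, MvPolynomial.C (c i) * p i, ?_, fun x => ?_⟩
  · refine MvPolynomial.totalDegree_finsetSum_le fun i _ => ?_
    refine (MvPolynomial.totalDegree_mul _ _).trans ?_
    rw [MvPolynomial.totalDegree_C, zero_add]
    exact hp i
  · simp [hpf, mul_comm]

section HarmonicMatrix

variable {t : ℕ} {Y : ℕ → ℕ → S2 → ℝ}

/-- The orthonormal system, with the numbering of the columns of `harmonicMatrix`. -/
def column (t : ℕ) (Y : ℕ → ℕ → S2 → ℝ) (j : Fin ((t + 1) ^ 2)) : S2 → ℝ :=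
  Y (Nat.sqrt j) (j - Nat.sqrt j ^ 2 + 1)

lemma sqrt_le_of_fin (j : Fin ((t + 1) ^ 2)) : Nat.sqrt j ≤ t :=
  Nat.lt_succ_iff.1 (Nat.sqrt_lt'.2 j.2)

lemma index_mem_Icc (j : ℕ) : j - Nat.sqrt j ^ 2 + 1 ∈ Finset.Icc 1 (2 * Nat.sqrt j + 1) := by
  rw [Finset.mem_Icc]
  have := Nat.sqrt_le_add j
  rw [sq]
  omega

lemma isSphericalHarmonic_column (hY : IsOrthonormalHarmonicSystem t Y) (j : Fin ((t + 1) ^ 2)) :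
    IsSphericalHarmonic (Nat.sqrt j) (column t Y j) :=
  hY.harmonic _ (sqrt_le_of_fin j) _ (index_mem_Icc j)

lemma isSphericalPolynomial_column (hY : IsOrthonormalHarmonicSystem t Y)
    (j : Fin ((t + 1) ^ 2)) : IsSphericalPolynomial t (column t Y j) :=
  (isSphericalHarmonic_column hY j).isSphericalPolynomial (sqrt_le_of_fin j)

lemma integral_column (hY : IsOrthonormalHarmonicSystem t Y) (i j : Fin ((t + 1) ^ 2)) :
    ∫ x, column t Y i x * column t Y j x ∂surfaceMeasure = if i = j then 1 else 0 := by
  unfold column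
  rw [hY.orthonormal _ (sqrt_le_of_fin i) _ (sqrt_le_of_fin j) _ (index_mem_Icc i) _
    (index_mem_Icc j)]
  congr 1
  rw [eq_iff_iff, Fin.ext_iff]
  constructor
  · rintro ⟨h1, h2⟩
    have hi := Nat.sqrt_le' (i : ℕ)
    have hj := Nat.sqrt_le' (j : ℕ)
    rw [h1] at h2 hi
    omega
  · intro h
    simp [h]

lemma linearIndependent_column (hY : IsOrthonormalHarmonicSystem t Y) :
    LinearIndependent ℝ (column t Y) :=
  linearIndependent_of_orthonormal (fun j => (isSphericalHarmonic_column hY j).continuous)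
    (integral_column hY)

lemma harmonicMatrix_mulVec {N : ℕ} (X : PointSet N) (c : Fin ((t + 1) ^ 2) → ℝ) (i : Fin N) :
    (harmonicMatrix t Y X).mulVec c i = ∑ j, column t Y j (X i) * c j := rfl

/-- A kernel vector gives a combination of the basis vanishing on `X`, hence everywhere, and the
basis is independent. -/
lemma isUnit_harmonicMatrix (hY : IsOrthonormalHarmonicSystem t Y)
    {X : PointSet ((t + 1) ^ 2)} (hX : IsFundamental t X) : IsUnit (harmonicMatrix t Y X) := by
  rw [← Matrix.mulVec_injective_iff_isUnit]
  change Function.Injective (Matrix.mulVecLin (harmonicMatrix t Y X))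
  rw [injective_iff_map_eq_zero]
  intro c hc
  have h0 := hX _ (IsSphericalPolynomial.sum_mul (isSphericalPolynomial_column hY) c) fun i =>
    congrFun hc i
  have hli := Fintype.linearIndependent_iff.1 (linearIndependent_column hY) c (by
    ext x
    simpa [mul_comm] using h0 x)
  exact funext hli

/-- Every spherical polynomial of degree at most `t` is a combination of the orthonormal system
(provided that a fundamental system with `(t + 1) ^ 2` points exists). -/
lemma exists_eq_sum_column (hY : IsOrthonormalHarmonicSystem t Y)
    {X : PointSet ((t + 1) ^ 2)} (hX : IsFundamental t X) {f : S2 → ℝ}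
    (hf : IsSphericalPolynomial t f) :
    ∃ c : Fin ((t + 1) ^ 2) → ℝ, ∀ x, f x = ∑ j, column t Y j x * c j := by
  -- Interpolate `f` at `X`: the difference vanishes on `X`, hence everywhere.
  obtain ⟨c, hc⟩ := Matrix.mulVec_surjective_iff_isUnit.2 (isUnit_harmonicMatrix hY hX)
    fun i => f (X i)
  refine ⟨c, fun x => sub_eq_zero.1 ?_⟩
  refine hX _ (hf.sub (IsSphericalPolynomial.sum_mul (isSphericalPolynomial_column hY) c))
    (fun i => ?_) x
  rw [sub_eq_zero, ← harmonicMatrix_mulVec, hc]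

end HarmonicMatrix

/-! ### Matching nearby point sets. -/

lemma geodist_comm (x y : S2) : geodist x y = geodist y x := by
  rw [geodist, geodist, real_inner_comm]

lemma geodist_eq_angle (x y : S2) : geodist x y = InnerProductGeometry.angle x.1 y.1 := by
  simp [geodist, InnerProductGeometry.angle]

lemma geodist_triangle (x y z : S2) : geodist x z ≤ geodist x y + geodist y z := by
  simp only [geodist_eq_angle]
  exact InnerProductGeometry.angle_le_angle_add_angle _ _ _

/-- Point sets whose Hausdorff distance is less than half the separation distance of one of them
can be matched. -/
lemma exists_perm_of_mem_neighborhood {N : ℕ} {X₀ X : PointSet N} {σ : ℝ}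
    (hσ : 2 * σ < separation X₀) (hX : X ∈ neighborhood X₀ σ) :
    ∃ π : Equiv.Perm (Fin N), ∀ i, geodist (X₀ i) (X (π i)) ≤ σ := by
  have hex : ∀ i, ∃ j, geodist (X₀ i) (X j) ≤ σ := by
    intro i
    have : Nonempty (Fin N) := ⟨i⟩
    obtain ⟨j, hj⟩ := exists_eq_ciInf_of_finite (f := fun j => geodist (X₀ i) (X j))
    refine ⟨j, hj.le.trans ?_⟩
    have h1 : leastDist (X₀ i) X ≤ ⨆ i, leastDist (X₀ i) X :=
      le_ciSup (f := fun i => leastDist (X₀ i) X) (Set.finite_range _).bddAbove i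
    exact h1.trans ((le_max_left _ _).trans hX)
  choose π hπ using hex
  -- Two points of `X₀` with a common partner would be at distance at most `2σ`.
  have hinj : Function.Injective π := by
    intro i j hij
    by_contra hne
    have h1 : separation X₀ ≤ geodist (X₀ i) (X₀ j) :=
      ciInf_le (f := fun p : {p : Fin N × Fin N // p.1 ≠ p.2} => geodist (X₀ p.1.1) (X₀ p.1.2))
        (Set.finite_range _).bddBelow ⟨(i, j), hne⟩
    have h2 := geodist_triangle (X₀ i) (X (π i)) (X₀ j)
    have h3 := hπ i
    have h4 := hπ j
    rw [geodist_comm, ← hij] at h4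
    linarith
  exact ⟨Equiv.ofBijective π (Finite.injective_iff_bijective.1 hinj), hπ⟩

/-! ### Perturbation of linear systems, for row vectors in the maximum norm. -/

lemma sum_abs_le_oneNorm {m n : ℕ} (A : Matrix (Fin m) (Fin n) ℝ) (j : Fin n) :
    ∑ i, |A i j| ≤ oneNorm A :=
  le_ciSup (f := fun j => ∑ i, |A i j|) (Set.finite_range _).bddAbove j

lemma oneNorm_nonneg {m n : ℕ} (A : Matrix (Fin m) (Fin n) ℝ) : 0 ≤ oneNorm A :=
  Real.iSup_nonneg fun _ => Finset.sum_nonneg fun _ _ => abs_nonneg _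

/-- The row vectors `w` and `w₀` which two matrices `A` and `A₀` map to the same vector differ by
at most `r M`, where `M` bounds `w` and `r` is the product of a bound for the column sums of
`A - A₀` and the norm of the inverse of `A₀`. -/
lemma abs_sub_le_of_vecMul_eq {n : ℕ} {A A₀ : Matrix (Fin n) (Fin n) ℝ} (hA₀ : IsUnit A₀) {κ : ℝ}
    (hκ : 0 ≤ κ) (hE : ∀ j, ∑ i, |A i j - A₀ i j| ≤ κ) {w w₀ : Fin n → ℝ}
    (hw : Matrix.vecMul w A = Matrix.vecMul w₀ A₀) {M : ℝ} (hM : 0 ≤ M) (hwM : ∀ i, |w i| ≤ M)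
    (i : Fin n) : |w i - w₀ i| ≤ κ * oneNorm A₀⁻¹ * M := by
  have hdet := (Matrix.isUnit_iff_isUnit_det _).1 hA₀
  have h1 : w - w₀ = -Matrix.vecMul (Matrix.vecMul w (A - A₀)) A₀⁻¹ := by
    rw [Matrix.vecMul_sub, hw, ← Matrix.sub_vecMul, Matrix.vecMul_vecMul,
      Matrix.mul_nonsing_inv _ hdet, Matrix.vecMul_one, neg_sub]
  have h2 : ∀ j, |Matrix.vecMul w (A - A₀) j| ≤ κ * M := by
    intro j
    calc |∑ i, w i * (A i j - A₀ i j)| ≤ ∑ i, |w i * (A i j - A₀ i j)| :=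
          Finset.abs_sum_le_sum_abs _ _
      _ ≤ ∑ i, M * |A i j - A₀ i j| := Finset.sum_le_sum fun i _ => by
          rw [abs_mul]
          exact mul_le_mul_of_nonneg_right (hwM i) (abs_nonneg _)
      _ = (∑ i, |A i j - A₀ i j|) * M := by rw [← Finset.mul_sum, mul_comm]
      _ ≤ κ * M := mul_le_mul_of_nonneg_right (hE j) hM
  have h3 := congrFun h1 i
  rw [Pi.sub_apply, Pi.neg_apply] at h3
  rw [h3, abs_neg]
  calc |∑ j, Matrix.vecMul w (A - A₀) j * A₀⁻¹ j i|
      ≤ ∑ j, |Matrix.vecMul w (A - A₀) j * A₀⁻¹ j i| := Finset.abs_sum_le_sum_abs _ _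
    _ ≤ ∑ j, κ * M * |A₀⁻¹ j i| := Finset.sum_le_sum fun j _ => by
        rw [abs_mul]
        exact mul_le_mul_of_nonneg_right (h2 j) (abs_nonneg _)
    _ = κ * M * ∑ j, |A₀⁻¹ j i| := by rw [Finset.mul_sum]
    _ ≤ κ * M * oneNorm A₀⁻¹ :=
        mul_le_mul_of_nonneg_left (sum_abs_le_oneNorm _ _) (mul_nonneg hκ hM)
    _ = κ * oneNorm A₀⁻¹ * M := by ring

/-- The maximum norm; requiring `0 ≤ B` covers `n = 0`, where the supremum is 0. -/
lemma exists_forall_abs_le {n : ℕ} (w : Fin n → ℝ) :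
    ∃ M, 0 ≤ M ∧ (∀ i, |w i| ≤ M) ∧ ∀ B, 0 ≤ B → (∀ i, |w i| ≤ B) → M ≤ B := by
  refine ⟨⨆ i, |w i|, Real.iSup_nonneg fun _ => abs_nonneg _,
    fun i => le_ciSup (f := fun i => |w i|) (Set.finite_range _).bddAbove i,
    fun B hB h => Real.iSup_le h hB⟩

/-- A small perturbation of an invertible matrix is invertible. -/
lemma isUnit_of_sum_abs_sub_le {n : ℕ} {A A₀ : Matrix (Fin n) (Fin n) ℝ} (hA₀ : IsUnit A₀) {κ : ℝ}
    (hκ : 0 ≤ κ) (hE : ∀ j, ∑ i, |A i j - A₀ i j| ≤ κ) (hr : κ * oneNorm A₀⁻¹ < 1) :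
    IsUnit A := by
  rw [← Matrix.vecMul_injective_iff_isUnit]
  change Function.Injective (Matrix.vecMulLinear A)
  rw [injective_iff_map_eq_zero]
  intro w hw
  obtain ⟨M, hM0, hM, hMin⟩ := exists_forall_abs_le w
  have h := abs_sub_le_of_vecMul_eq hA₀ hκ hE (w := w) (w₀ := 0)
    (by rw [Matrix.zero_vecMul]; exact hw) hM0 hM
  simp only [Pi.zero_apply, sub_zero] at h
  have hr0 := mul_nonneg hκ (oneNorm_nonneg A₀⁻¹)
  have h1 := hMin _ (mul_nonneg hr0 hM0) h
  -- `M ≤ r M` with `r < 1`.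
  have hM' : M = 0 := by nlinarith
  ext i
  have := hM i
  rw [hM'] at this
  exact abs_nonpos_iff.1 this

/-- The solution of the perturbed system is close to a constant solution of the original one. -/
lemma abs_sub_const_le {n : ℕ} {A A₀ : Matrix (Fin n) (Fin n) ℝ} (hA₀ : IsUnit A₀) {κ : ℝ}
    (hκ : 0 ≤ κ) (hE : ∀ j, ∑ i, |A i j - A₀ i j| ≤ κ) (hr : κ * oneNorm A₀⁻¹ < 1)
    {w : Fin n → ℝ} {a : ℝ} (ha : 0 ≤ a)
    (hw : Matrix.vecMul w A = Matrix.vecMul (fun _ => a) A₀) (i : Fin n) :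
    |w i - a| ≤ κ * oneNorm A₀⁻¹ / (1 - κ * oneNorm A₀⁻¹) * a := by
  obtain ⟨M, hM0, hM, hMin⟩ := exists_forall_abs_le w
  have h := abs_sub_le_of_vecMul_eq hA₀ hκ hE hw hM0 hM
  have hr0 := mul_nonneg hκ (oneNorm_nonneg A₀⁻¹)
  set r := κ * oneNorm A₀⁻¹
  have h1 : M ≤ r * M + a := hMin _ (by positivity) fun i => by
    have h2 := abs_sub_abs_le_abs_sub (w i) a
    rw [abs_of_nonneg ha] at h2
    linarith [h i]
  have h1r : 0 < 1 - r := by linarith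
  have h3 : M ≤ a / (1 - r) := by
    rw [le_div_iff₀ h1r]
    linarith
  calc |w i - a| ≤ r * M := h i
    _ ≤ r * (a / (1 - r)) := mul_le_mul_of_nonneg_left h3 hr0
    _ = r / (1 - r) * a := by ring

end SphericalDesign

end

/-! ### The main theorem. -/

open SphericalDesign in
theorem lemma2p3 (t : ℕ) (ht : 1 ≤ t)
    (Y : ℕ → ℕ → S2 → ℝ) (hY : IsOrthonormalHarmonicSystem t Y)
    (X₀ : PointSet ((t + 1) ^ 2)) (hfund : IsFundamental t X₀) (hdes : IsDesign t X₀)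
    (σ : ℝ) (hσ₀ : 0 ≤ σ)
    (hσ : σ < 1 / 2 * min (1 / (tau t * oneNorm (harmonicMatrix t Y X₀)⁻¹)) (separation X₀))
    (X : PointSet ((t + 1) ^ 2)) (hX : X ∈ neighborhood X₀ σ)
    (ε : ℝ)
    (hε : tau t * σ * oneNorm (harmonicMatrix t Y X₀)⁻¹ /
      (1 - tau t * σ * oneNorm (harmonicMatrix t Y X₀)⁻¹) ≤ ε)
    (hε₁ : ε < 1) :
    IsFundamental t X ∧ IsEpsDesign t ε X := by
  have hmin₁ := min_le_left (1 / (tau t * oneNorm (harmonicMatrix t Y X₀)⁻¹)) (separation X₀)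
  have hmin₂ := min_le_right (1 / (tau t * oneNorm (harmonicMatrix t Y X₀)⁻¹)) (separation X₀)
  obtain ⟨π, hπ⟩ := exists_perm_of_mem_neighborhood (σ := σ) (by linarith) hX
  have hA₀ := isUnit_harmonicMatrix hY hfund
  set A₀ := harmonicMatrix t Y X₀ with hA₀_def
  set A : Matrix (Fin ((t + 1) ^ 2)) (Fin ((t + 1) ^ 2)) ℝ :=
    harmonicMatrix t Y (π.toEmbedding.trans X) with hA_def
  have hτ : 0 ≤ tau t := by unfold tau; positivity
  have hκ : 0 ≤ tau t * σ := mul_nonneg hτ hσ₀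
  have hB := oneNorm_nonneg A₀⁻¹
  have hr : tau t * σ * oneNorm A₀⁻¹ < 1 := by
    -- If the product were 0, then `1 / 0 = 0` would turn the bound on `σ` into `σ < 0`.
    have hpos : 0 < tau t * oneNorm A₀⁻¹ := by
      by_contra hneg
      have h0 : tau t * oneNorm A₀⁻¹ = 0 := le_antisymm (not_lt.1 hneg) (mul_nonneg hτ hB)
      rw [h0, div_zero] at hmin₁ hσ
      linarith
    have h2 : σ < 1 / (tau t * oneNorm A₀⁻¹) := by linarith
    rw [lt_div_iff₀ hpos] at h2
    linarith
  have hE : ∀ j, ∑ i, |A i j - A₀ i j| ≤ tau t * σ := by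
    intro j
    have hij : ∀ i, |A i j - A₀ i j|
        ≤ Real.sqrt ((2 * t + 1) / (4 * Real.pi)) * (t + 1) * σ := fun i =>
      (hY.abs_sub_le (sqrt_le_of_fin j) (index_mem_Icc j) (X₀ i) (X (π i))).trans
        (mul_le_mul_of_nonneg_left (hπ i) (by positivity))
    -- The `(t + 1)²` rows turn the factor `t + 1` into the `(t + 1)³` of `tau`.
    refine (Finset.sum_le_sum fun i _ => hij i).trans (le_of_eq ?_)
    rw [Finset.sum_const, Finset.card_univ, Fintype.card_fin, nsmul_eq_mul, tau]
    push_cast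
    ring
  have hA := isUnit_of_sum_abs_sub_le hA₀ hκ hE hr
  have hNpos : (0 : ℝ) < ((t + 1) ^ 2 : ℕ) := by positivity
  have harea : 0 < area := by
    rw [area_eq]
    positivity
  set a : ℝ := area / ((t + 1) ^ 2 : ℕ) with ha_def
  have ha : 0 < a := div_pos harea hNpos
  constructor
  · intro f hf hfX
    obtain ⟨c, hc⟩ := exists_eq_sum_column hY hfund hf
    have hAc : A.mulVec c = A.mulVec 0 := by
      rw [Matrix.mulVec_zero]
      ext i
      rw [hA_def, harmonicMatrix_mulVec, ← hc]
      exact hfX _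
    have hc0 := Matrix.mulVec_injective_iff_isUnit.2 hA hAc
    intro x
    rw [hc, hc0]
    simp
  · have hr0 : 0 ≤ tau t * σ * oneNorm A₀⁻¹ := mul_nonneg hκ hB
    have hε₀ : 0 ≤ ε := (div_nonneg hr0 (by linarith)).trans hε
    obtain ⟨w, hw⟩ := Matrix.vecMul_surjective_iff_isUnit.2 hA (Matrix.vecMul (fun _ => a) A₀)
    replace hw : Matrix.vecMul w A = Matrix.vecMul (fun _ => a) A₀ := hw
    have hwa : ∀ i, |w i - a| ≤ ε * a := fun i =>
      (abs_sub_const_le hA₀ hκ hE hr ha.le hw i).trans (mul_le_mul_of_nonneg_right hε ha.le)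
    -- `w` is numbered along `X₀`; `π.symm` transfers it to the numbering of `X`.
    refine ⟨hε₀, hε₁, fun i => w (π.symm i), fun i => ?_, fun f hf => ?_⟩
    · obtain ⟨h1, h2⟩ := abs_le.1 (hwa (π.symm i))
      constructor
      · linarith
      -- This is `(1 + ε)(1 - ε) ≤ 1`.
      · have h3 : 1 + ε ≤ (1 - ε)⁻¹ := by
          rw [le_inv_comm₀ (by linarith) (by linarith), inv_eq_one_div, le_div_iff₀ (by linarith)]
          nlinarith
        have h4 := mul_le_mul_of_nonneg_left h3 ha.le
        linarith
    · obtain ⟨c, hc⟩ := exists_eq_sum_column hY hfund hf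
      have hval : ∀ i, f (X (π i)) = A.mulVec c i := fun i => by
        rw [hA_def, harmonicMatrix_mulVec, hc]
        rfl
      have hval₀ : ∀ i, f (X₀ i) = A₀.mulVec c i := fun i => by
        rw [hA₀_def, harmonicMatrix_mulVec, hc]
      rw [← Equiv.sum_comp π]
      simp only [Equiv.symm_apply_apply, hval]
      -- `w · Ac = wA · c = a𝟙A₀ · c`, which is `a` times the sum of `f` over `X₀`; the design
      -- property turns it into the integral.
      change dotProduct w (A.mulVec c) = _
      rw [Matrix.dotProduct_mulVec, hw, ← Matrix.dotProduct_mulVec]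
      have hd := hdes f hf
      simp only [hval₀] at hd
      change ∑ i, a * A₀.mulVec c i = _
      rw [← Finset.mul_sum, ha_def, div_eq_mul_one_div, mul_assoc, hd, ← mul_assoc,
        mul_one_div_cancel harea.ne', one_mul]
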